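/- Let $G$ be a connected (finite-dimensional, real, smooth) Lie group with identity $e$, let $\mathfrak g$ be the Lie algebra of right-invariant vector fields on $G$, with the bracket of vector fields, and let $\exp\colon\mathfrak g\to G$ be the exponential map. Let $\mathcal X$ be a linear vector field on $G$, i.e. a smooth vector field whose flow $(\varphi_t)_{t\in\mathbb R}$ is a one-parameter group of automorphisms of $G$, and let $\mathcal D$ be its associated derivation of $\mathfrak g$, $\mathcal D(Y)=-[\mathcal X,Y]$. Suppose that $\mathcal D$ is inner, i.e. $\mathcal D=-\operatorname{ad}(X)$ for some $X\in\mathfrak g$ (that is, $[\mathcal X,Y]=[X,Y]$ for all $Y\in\mathfrak g$). Then: 1. $\mathcal X=X+dI\,X$, where $dI\,X$ is the left-invariant vector field obtained by pushing $X$ forward under the inversion $I(g)=g^{-1}$, and $\varphi_t(g)=\exp(tX)\,g\,\exp(-tX)$ for all $t\in\mathbb R$ and $g\in G$. 2. Let $Y_1,\dots,Y_m\in\mathfrak g$, let $u\colon\mathbb R\to\mathbb R^m$ be piecewise constant (locally constant off a set of jump times that has finitely many points in each bounded interval), and suppose that $u$ is constant on $[0,T]$, $T\ge 0$, with value $(u_1,\dots,u_m)$.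 Then the curve $$\phi_t(u,e)=\exp\Big(tX+t\sum_{j=1}^m u_jY_j\Big)\exp(-tX),\qquad 0\le t\le T,$$ is on $[0,T]$ the unique solution starting at $e$ at time $0$ of the linear control system $$\frac{dg}{dt}=\mathcal X(g)+\sum_{j=1}^m u_j(t)\,Y_j(g):$$ it is a solution on $[0,T]$, and every solution with control $u$ starting at $e$ at time $0$, on any interval containing $[0,T]$, coincides with it on $[0,T]$. (A solution is a continuous curve which satisfies the equation at all times of its interval of definition $J$ at which the restriction of $u$ to $J$ is locally constant.) In particular, if the Lie algebra of $G$ is semisimple (its solvable radical is zero), then for every linear vector field $\mathcal X$ on $G$ such an $X\in\mathfrak g$ exists, so that 1 and 2 hold. -/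

import Mathlib

open scoped Manifold ContDiff

/-- A smooth real Lie group has the regularity under which its Lie algebra is set up. -/
instance instLieGroupMinSmoothnessThree {E : Type*} [NormedAddCommGroup E] [NormedSpace ℝ E]
    {H : Type*} [TopologicalSpace H] {I : ModelWithCorners ℝ E H}
    {G : Type*} [TopologicalSpace G] [ChartedSpace H G] [Group G] [LieGroup I ∞ G] :
    LieGroup I (minSmoothness ℝ 3) G :=
  LieGroup.of_le (n := ∞) (by
    rw [minSmoothness_of_isRCLikeNormedField]
    exact ENat.LEInfty.out)

noncomputable section

namespace LinearControl

variable {E : Type*} [NormedAddCommGroup E] [NormedSpace ℝ E]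
  {H : Type*} [TopologicalSpace H] {I : ModelWithCorners ℝ E H}
  {G : Type*} [TopologicalSpace G] [ChartedSpace H G] [Group G]

/-- The right-invariant vector field `g ↦ d(R_g)_e v` with value `v` at the identity. Through
`v ↦ rightInvariant v` the space `GroupLieAlgebra I G` (the tangent space at the identity) is
identified with the space `𝔤` of right-invariant vector fields. -/
def rightInvariant (v : GroupLieAlgebra I G) (g : G) : TangentSpace I g :=
  mfderiv I I (fun x : G => x * g) (1 : G) v

/-- The vector field `dI V` induced from `V` by the inversion map `x ↦ x⁻¹`, that is, the
push-forward `g ↦ d(inv)_{g⁻¹} (V (g⁻¹))`. -/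
def inversionField (V : (g : G) → TangentSpace I g) (g : G) : TangentSpace I g :=
  mfderiv I I (fun x : G => x⁻¹) g⁻¹ (V g⁻¹)

/-- The exponential map of the Lie group: `lieExp v = γ 1`, where `γ : ℝ → G` is the integral curve
with `γ 0 = 1` of the right-invariant vector field determined by `v`. -/
def lieExp (v : GroupLieAlgebra I G) : G :=
  (Classical.epsilon fun γ : ℝ → G => γ 0 = 1 ∧ IsMIntegralCurve γ (rightInvariant v)) 1

/-- `φ` is the (global) flow of the vector field `V`. -/
structure IsFlow (V : (g : G) → TangentSpace I g) (φ : ℝ → G → G) : Prop where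
  map_zero : ∀ g, φ 0 g = g
  isMIntegralCurve : ∀ g, IsMIntegralCurve (fun t => φ t g) V

/-- A smooth vector field is linear if its flow is a one-parameter group of automorphisms of the
Lie group. -/
structure IsLinearVectorField [LieGroup I ∞ G] (V : (g : G) → TangentSpace I g) : Prop where
  smooth : ContMDiff I I.tangent ∞ (fun g => (⟨g, V g⟩ : TangentBundle I G))
  exists_flow : ∃ φ : ℝ → G ≃* G, IsFlow V (fun t => φ t) ∧
    (∀ s t, φ (s + t) = (φ t).trans (φ s)) ∧ ∀ t, ContMDiff I I ∞ (φ t)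

/-- The derivation `D` of `𝔤` associated to a linear vector field `V`: `D Y = -[V, Y]`, the bracket
being that of vector fields on the group. -/
def derivationOf (V : (g : G) → TangentSpace I g) (Y : GroupLieAlgebra I G) :
    (g : G) → TangentSpace I g :=
  -VectorField.mlieBracket I V (rightInvariant Y)

/-- The derivation `D` associated to `V` is inner, given by `X`: `D = -ad X` on the Lie algebra `𝔤`
of right-invariant vector fields, i.e. `D Y = -[X, Y]` for all `Y` in `𝔤`. -/
def IsInnerBy (V : (g : G) → TangentSpace I g) (X : GroupLieAlgebra I G) : Prop :=
  ∀ Y : GroupLieAlgebra I G,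
    derivationOf V Y = -VectorField.mlieBracket I (rightInvariant X) (rightInvariant Y)

/-- Admissible controls: piecewise constant functions on the line, i.e. functions that are locally
constant off a set of jump times having finitely many points in every bounded interval. -/
def IsPiecewiseConstant {m : ℕ} (u : ℝ → Fin m → ℝ) : Prop :=
  ∃ S : Set ℝ, (∀ a b : ℝ, (S ∩ Set.Icc a b).Finite) ∧
    ∀ t ∉ S, ∀ᶠ τ in nhds t, u τ = u t

/-- `γ` is, on the time interval `J`, a solution of the control system
`dg/dt = V(g) + ∑ j, u j (t) • Y j (g)` for the piecewise constant control `u`, starting at `g₀`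
at time `0`: it is continuous on `J` and satisfies the equation at all times of `J` other than the
jump times of the restriction of `u` to `J` (one-sidedly at end points of `J` that belong to `J`). -/
structure IsSolutionOn {m : ℕ} (V : (g : G) → TangentSpace I g)
    (Y : Fin m → GroupLieAlgebra I G) (u : ℝ → Fin m → ℝ) (g₀ : G) (γ : ℝ → G) (J : Set ℝ) :
    Prop where
  initial : γ 0 = g₀
  continuousOn : ContinuousOn γ J
  equation : ∀ t ∈ J, (∀ᶠ τ in nhdsWithin t J, u τ = u t) →
    HasMFDerivWithinAt 𝓘(ℝ, ℝ) I γ J t ((1 : ℝ →L[ℝ] ℝ).smulRight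
      (V (γ t) + ∑ j, u t j • rightInvariant (Y j) (γ t)))

end LinearControl

end

/-! ### Invariant fields under translations, and derivatives of curves. -/

namespace LinearControl

open VectorField Set

variable {E : Type*} [NormedAddCommGroup E] [NormedSpace ℝ E]
  {H : Type*} [TopologicalSpace H] {I : ModelWithCorners ℝ E H}
  {G : Type*} [TopologicalSpace G] [ChartedSpace H G] [Group G]

/-! Put `Z = 𝒳 - X`. Innerness of the derivation says that `Z` commutes with every right-invariant
field. On a connected group this forces `Z` to be left-invariant
(`eq_mulInvariantVectorField_of_commute`), and since `𝒳` vanishes at the identity, its value there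
is `-X`. Hence `𝒳` is the right-invariant field of `X` plus the left-invariant field of `-X`, and
the latter is `dI X`.

A sum of the right-invariant field of `A` and the left-invariant field of `B` has the integral
curves `exp(tA) g exp(tB)` (`isMIntegralCurve_mul_mul`). Taking `A = X`, `B = -X` gives the flow. A
constant control only replaces `A` by `X + ∑ u_j Y_j`, and uniqueness of integral curves does the
rest.

The commutation criterion rests on two facts. Left- and right-invariant fields commute, because in a
chart they are the two partial derivatives of the multiplication and second derivatives are
symmetric. Conversely, the coefficients of `Z` in a left-invariant frame are annihilated by all
right-invariant fields; these span each tangent space, so the coefficients are constant.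

In the semisimple case, bracketing with `𝒳` is a derivation of the Lie algebra, and every derivation
is inner when the Killing form is nondegenerate. -/

lemma rightInvariant_add (v w : GroupLieAlgebra I G) :
    rightInvariant (v + w) = rightInvariant v + rightInvariant w := by
  ext g
  exact (mfderiv I I (fun x : G => x * g) (1 : G)).map_add v w

lemma rightInvariant_smul (c : ℝ) (v : GroupLieAlgebra I G) :
    rightInvariant (c • v) = c • rightInvariant v := by
  ext g
  exact (mfderiv I I (fun x : G => x * g) (1 : G)).map_smul c v

lemma rightInvariant_one (v : GroupLieAlgebra I G) : rightInvariant v 1 = v := by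
  have : (fun x : G => x * 1) = id := by ext x; simp
  rw [rightInvariant, this, mfderiv_id]
  rfl

lemma mulInvariantVectorField_one (v : GroupLieAlgebra I G) :
    mulInvariantVectorField v (1 : G) = v := by
  have : (fun x : G => 1 * x) = id := by ext x; simp
  rw [mulInvariantVectorField, this, mfderiv_id]
  rfl

variable [LieGroup I ∞ G]

lemma mdifferentiableAt_mul_left (g h : G) : MDifferentiableAt I I (fun x => g * x) h :=
  (contMDiff_mul_left (n := ∞)).mdifferentiableAt (by simp)

lemma mdifferentiableAt_mul_right (g h : G) : MDifferentiableAt I I (fun x => x * g) h :=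
  (contMDiff_mul_right (n := ∞)).mdifferentiableAt (by simp)

lemma mdifferentiableAt_inv (g : G) : MDifferentiableAt I I (fun x : G => x⁻¹) g :=
  (contMDiff_inv I ∞).mdifferentiableAt (by simp)

lemma mfderiv_mul_right_rightInvariant (v : GroupLieAlgebra I G) (g h : G) :
    mfderiv I I (fun x => x * h) g (rightInvariant v g) = rightInvariant v (g * h) := by
  have D : (fun x : G => x * (g * h)) = (fun x => x * h) ∘ (fun x => x * g) := by
    ext x; simp [mul_assoc]
  rw [rightInvariant, rightInvariant, D]
  exact (mfderiv_comp_apply_of_eq (I' := I) _ (mdifferentiableAt_mul_right h g)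
    (mdifferentiableAt_mul_right g 1) (one_mul g) v).symm

lemma mfderiv_mul_left_mulInvariantVectorField (v : GroupLieAlgebra I G) (g h : G) :
    mfderiv I I (fun x => g * x) h (mulInvariantVectorField v h) =
      mulInvariantVectorField v (g * h) := by
  have D : (fun x : G => g * h * x) = (fun x => g * x) ∘ (fun x => h * x) := by
    ext x; simp [mul_assoc]
  rw [mulInvariantVectorField, mulInvariantVectorField, D]
  exact (mfderiv_comp_apply_of_eq (I' := I) _ (mdifferentiableAt_mul_left g h)
    (mdifferentiableAt_mul_left h 1) (mul_one h) v).symm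

/-- The derivative of a product of two curves. -/
lemma hasMFDerivAt_mul_curve {a b : ℝ → G} {t : ℝ} {va : TangentSpace I (a t)}
    {vb : TangentSpace I (b t)}
    (ha : HasMFDerivAt 𝓘(ℝ, ℝ) I a t ((1 : ℝ →L[ℝ] ℝ).smulRight va))
    (hb : HasMFDerivAt 𝓘(ℝ, ℝ) I b t ((1 : ℝ →L[ℝ] ℝ).smulRight vb)) :
    HasMFDerivAt 𝓘(ℝ, ℝ) I (fun s => a s * b s) t ((1 : ℝ →L[ℝ] ℝ).smulRight
      (mfderiv I I (fun x => x * b t) (a t) va + mfderiv I I (fun x => a t * x) (b t) vb)) := by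
  have hm : MDifferentiableAt (I.prod I) I (fun p : G × G => p.1 * p.2) (a t, b t) :=
    (contMDiff_mul I ∞).mdifferentiableAt (by simp)
  have := hm.hasMFDerivAt.comp t (ha.prodMk hb)
  refine this.congr_mfderiv ?_
  ext
  have h := mfderiv_prod_eq_add_apply (v := ((va, vb) : E × E)) hm
  change mfderiv (I.prod I) I (fun p : G × G => p.1 * p.2) (a t, b t)
    (((1 : ℝ) • va, (1 : ℝ) • vb) : E × E) = (1 : ℝ) • _
  rw [one_smul, one_smul, one_smul]
  exact h

omit [Group G] [LieGroup I ∞ G] in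
/-- The image of a curve under a differentiable map. -/
lemma hasMFDerivAt_comp_curve {a : ℝ → G} {f : G → G} {t : ℝ} {v : TangentSpace I (a t)}
    (ha : HasMFDerivAt 𝓘(ℝ, ℝ) I a t ((1 : ℝ →L[ℝ] ℝ).smulRight v))
    (hf : MDifferentiableAt I I f (a t)) :
    HasMFDerivAt 𝓘(ℝ, ℝ) I (fun s => f (a s)) t ((1 : ℝ →L[ℝ] ℝ).smulRight
      (mfderiv I I f (a t) v)) := by
  refine (hf.hasMFDerivAt.comp t ha).congr_mfderiv ?_
  ext
  exact (mfderiv I I f (a t)).map_smul (1 : ℝ) v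

end LinearControl

/-! ### Smoothness of invariant fields, and their brackets via inversion. -/

namespace LinearControl

open VectorField Set Bundle

variable {E : Type*} [NormedAddCommGroup E] [NormedSpace ℝ E]
  {H : Type*} [TopologicalSpace H] {I : ModelWithCorners ℝ E H}
  {G : Type*} [TopologicalSpace G] [ChartedSpace H G] [Group G] [LieGroup I ∞ G]

/-- The tangent map of the multiplication, applied to two smooth maps into the tangent bundle. -/
lemma contMDiff_tangent_mul {A B : G → TangentBundle I G} (hA : ContMDiff I I.tangent ∞ A)
    (hB : ContMDiff I I.tangent ∞ B) :
    ContMDiff I I.tangent ∞ (fun g => (⟨(A g).1 * (B g).1,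
      mfderiv I I (fun x => x * (B g).1) (A g).1 (A g).2 +
        mfderiv I I (fun x => (A g).1 * x) (B g).1 (B g).2⟩ : TangentBundle I G)) := by
  have S₂ : ContMDiff (I.tangent.prod I.tangent) (I.prod I).tangent ∞
    (equivTangentBundleProd I G I G).symm := contMDiff_equivTangentBundleProd_symm
  have S₃ : ContMDiff (I.prod I).tangent I.tangent ∞
      (tangentMap (I.prod I) I (fun p : G × G => p.1 * p.2)) :=
    ContMDiff.contMDiff_tangentMap (contMDiff_mul I ∞) (by simp)
  refine ((S₃.comp S₂).comp (hA.prodMk hB)).congr fun g => ?_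
  have hm : MDifferentiableAt (I.prod I) I (fun p : G × G => p.1 * p.2) ((A g).1, (B g).1) :=
    (contMDiff_mul I ∞).mdifferentiableAt (by simp)
  have h := mfderiv_prod_eq_add_apply (v := (((A g).2, (B g).2) : E × E)) hm
  exact congrArg (fun v => (⟨(A g).1 * (B g).1, v⟩ : TangentBundle I G)) h.symm

lemma contMDiff_rightInvariant (v : GroupLieAlgebra I G) :
    ContMDiff I I.tangent ∞ (fun g : G => (⟨g, rightInvariant v g⟩ : TangentBundle I G)) := by
  have := contMDiff_tangent_mul (I := I) (A := fun _ : G => ⟨1, v⟩) (B := fun g => ⟨g, 0⟩)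
    contMDiff_const (contMDiff_zeroSection _ _)
  refine this.congr fun g => ?_
  have h : mfderiv I I (fun x => 1 * x) g (0 : TangentSpace I g) = 0 := map_zero _
  ext
  · simp
  · simp only [h, rightInvariant, add_zero]
    exact HEq.rfl

lemma contMDiff_mulInvariantVectorField_top (v : GroupLieAlgebra I G) :
    ContMDiff I I.tangent ∞
      (fun g : G => (⟨g, mulInvariantVectorField v g⟩ : TangentBundle I G)) := by
  have := contMDiff_tangent_mul (I := I) (B := fun _ : G => ⟨1, v⟩) (A := fun g => ⟨g, 0⟩)
    (contMDiff_zeroSection _ _) contMDiff_const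
  refine this.congr fun g => ?_
  have h : mfderiv I I (fun x => x * 1) g (0 : TangentSpace I g) = 0 := map_zero _
  ext
  · simp
  · simp only [h, mulInvariantVectorField, zero_add]
    exact HEq.rfl

-- The hypothesis `g = 1` lets this apply at points such as `1⁻¹`, where rewriting inside the
-- dependent tangent spaces would fail.
omit [LieGroup I ∞ G] in
lemma mfderiv_mul_right_of_eq_one {g : G} (hg : g = 1) (x : G) (v : E) :
    (mfderiv I I (fun z => z * g) x v : E) = v := by
  subst hg
  have : (fun z : G => z * 1) = id := by ext; simp
  rw [this, mfderiv_id]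
  rfl

omit [LieGroup I ∞ G] in
lemma mfderiv_mul_left_of_eq_one {g : G} (hg : g = 1) (x : G) (v : E) :
    (mfderiv I I (fun z => g * z) x v : E) = v := by
  subst hg
  have : (fun z : G => 1 * z) = id := by ext; simp
  rw [this, mfderiv_id]
  rfl

/-- Differentiate `x * x⁻¹ = 1` at the identity, where both partial derivatives of the product are
the identity map. -/
lemma mfderiv_inv_one (v : GroupLieAlgebra I G) :
    mfderiv I I (fun x : G => x⁻¹) 1 v = (-v : E) := by
  have hm : MDifferentiableAt (I.prod I) I (fun p : G × G => p.1 * p.2) (1, 1⁻¹) :=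
    (contMDiff_mul I ∞).mdifferentiableAt (by simp)
  have hp := (hasMFDerivAt_id (I := I) (1 : G)).prodMk
    (mdifferentiableAt_inv (I := I) (1 : G)).hasMFDerivAt
  have hc := (hm.hasMFDerivAt.comp (1 : G) hp)
  have h0 : HasMFDerivAt I I ((fun p : G × G => p.1 * p.2) ∘ fun x => (id x, x⁻¹)) (1 : G)
      (0 : E →L[ℝ] E) := by
    have : ((fun p : G × G => p.1 * p.2) ∘ fun x => (id x, x⁻¹)) = fun _ => 1 := by
      ext x; simp
    rw [this]
    exact hasMFDerivAt_const _ _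
  have h1 := congrArg (fun L : E →L[ℝ] E => L v) (hasMFDerivAt_unique hc h0)
  have h2 := mfderiv_prod_eq_add_apply
    (v := ((v, mfderiv I I (fun x : G => x⁻¹) 1 v) : E × E)) hm
  have h3 := h2.symm.trans h1
  have e1 := mfderiv_mul_right_of_eq_one (I := I) (inv_one (G := G)) 1 v
  have e2 := mfderiv_mul_left_of_eq_one (I := I) (rfl : (1 : G) = 1) 1⁻¹
    (mfderiv I I (fun x : G => x⁻¹) 1 v)
  refine eq_neg_of_add_eq_zero_right (Eq.trans ?_ h3)
  exact (congrArg₂ (fun a b : E => a + b) e1 e2).symm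

/-- The field induced from a right-invariant one by the inversion is left-invariant. -/
lemma inversionField_rightInvariant (v : GroupLieAlgebra I G) :
    inversionField (rightInvariant v) = mulInvariantVectorField (-v) := by
  ext g
  have h1 := mfderiv_comp_apply_of_eq (I' := I) (x := (1 : G)) (y := g⁻¹)
    (f := fun x : G => x * g⁻¹) (g := fun x : G => x⁻¹)
    (mdifferentiableAt_inv (I := I) g⁻¹) (mdifferentiableAt_mul_right g⁻¹ 1) (one_mul _) v
  have h2 := mfderiv_comp_apply_of_eq (I' := I) (x := (1 : G)) (y := 1)
    (f := fun x : G => x⁻¹) (g := fun x : G => g * x)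
    (mdifferentiableAt_mul_left g 1) (mdifferentiableAt_inv (I := I) 1) inv_one v
  have e : (fun x : G => x⁻¹) ∘ (fun x : G => x * g⁻¹) = (fun x : G => g * x) ∘ fun x => x⁻¹ := by
    ext x; simp
  rw [e] at h1
  rw [inversionField, rightInvariant, mulInvariantVectorField]
  refine h1.symm.trans (h2.trans ?_)
  rw [mfderiv_inv_one]

/-- The witness is `Ad(g) v`, because `g (y x) = (g y g⁻¹) (g x)`. -/
lemma mfderiv_mul_left_rightInvariant (g : G) (v : GroupLieAlgebra I G) :
    ∃ w : GroupLieAlgebra I G, ∀ x : G,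
      mfderiv I I (fun x => g * x) x (rightInvariant v x) = rightInvariant w (g * x) := by
  refine ⟨(mfderiv I I (fun x : G => g * x * g⁻¹) 1 v : E), fun x => ?_⟩
  have h1 := mfderiv_comp_apply_of_eq (I' := I) (x := (1 : G)) (y := x)
    (f := fun y : G => y * x) (g := fun y : G => g * y)
    (mdifferentiableAt_mul_left g x) (mdifferentiableAt_mul_right x 1) (one_mul _) v
  have h2 := mfderiv_comp_apply_of_eq (I' := I) (x := (1 : G)) (y := 1)
    (f := fun y : G => g * y * g⁻¹) (g := fun y : G => y * (g * x))
    (mdifferentiableAt_mul_right (g * x) 1)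
    ((mdifferentiableAt_mul_right g⁻¹ (g * 1)).comp 1 (mdifferentiableAt_mul_left g 1))
    (by simp) v
  have e : (fun y : G => g * y) ∘ (fun y : G => y * x) =
      (fun y : G => y * (g * x)) ∘ fun y => g * y * g⁻¹ := by
    ext y; simp [mul_assoc]
  rw [e] at h1
  exact h1.symm.trans h2

/-- Right translation as a diffeomorphism. -/
def rightTranslation (h : G) : Diffeomorph I I G G ∞ where
  toEquiv := Equiv.mulRight h
  contMDiff_toFun := contMDiff_mul_right
  contMDiff_invFun := contMDiff_mul_right

/-- Left translation as a diffeomorphism. -/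
def leftTranslation (h : G) : Diffeomorph I I G G ∞ where
  toEquiv := Equiv.mulLeft h
  contMDiff_toFun := contMDiff_mul_left
  contMDiff_invFun := contMDiff_mul_left

/-- Inversion as a diffeomorphism. -/
def inversion : Diffeomorph I I G G ∞ where
  toEquiv := Equiv.inv G
  contMDiff_toFun := contMDiff_inv I ∞
  contMDiff_invFun := contMDiff_inv I ∞

lemma mfderiv_diffeomorph_isInvertible {M : Type*} [TopologicalSpace M] [ChartedSpace H M]
    (f : Diffeomorph I I M M ∞) (x : M) : (mfderiv I I f x).IsInvertible :=
  ⟨f.mfderivToContinuousLinearEquiv (by simp) x, rfl⟩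

/-- Lie brackets of fields related by a diffeomorphism are related. -/
lemma mfderiv_mlieBracket_of_related [CompleteSpace E] {M : Type*} [TopologicalSpace M]
    [ChartedSpace H M] [IsManifold I ∞ M] (f : Diffeomorph I I M M ∞)
    {V W V' W' : (x : M) → TangentSpace I x}
    (hV : ∀ x, mfderiv I I f x (V x) = V' (f x)) (hW : ∀ x, mfderiv I I f x (W x) = W' (f x))
    (sV : MDifferentiable I I.tangent (fun x => (⟨x, V' x⟩ : TangentBundle I M)))
    (sW : MDifferentiable I I.tangent (fun x => (⟨x, W' x⟩ : TangentBundle I M))) (x : M) :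
    mfderiv I I f x (mlieBracket I V W x) = mlieBracket I V' W' (f x) := by
  have pull {U U' : (x : M) → TangentSpace I x} (hU : ∀ x, mfderiv I I f x (U x) = U' (f x)) :
      mpullback I I f U' = U := by
    ext x
    rw [mpullback_apply, ← hU, (mfderiv_diffeomorph_isInvertible f x).inverse_apply_eq]
  have : IsManifold I (minSmoothness ℝ 3) M := IsManifold.of_le (n := ∞) (by
    rw [minSmoothness_of_isRCLikeNormedField]
    exact ENat.LEInfty.out)
  have h := mpullback_mlieBracket (I := I) (I' := I) (f := f) (x₀ := x) (n := ∞) (sV (f x)) (sW (f x))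
    f.contMDiff.contMDiffAt (by
      rw [minSmoothness_of_isRCLikeNormedField]
      exact ENat.LEInfty.out)
  rw [pull hV, pull hW, mpullback_apply,
    (mfderiv_diffeomorph_isInvertible f x).inverse_apply_eq] at h
  exact h.symm

lemma mfderiv_inv_rightInvariant (v : GroupLieAlgebra I G) (x : G) :
    mfderiv I I (fun x : G => x⁻¹) x (rightInvariant v x) =
      mulInvariantVectorField (-v) x⁻¹ := by
  have h (y : G) (hy : x = y⁻¹) : (mfderiv I I (fun x : G => x⁻¹) x (rightInvariant v x) : E) =
      (mulInvariantVectorField (-v) y : E) := by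
    subst hy
    exact congrFun (inversionField_rightInvariant v) y
  exact h x⁻¹ (inv_inv x).symm

/-- Inversion relates the right-invariant field of `v` to the left-invariant field of `-v`, and
brackets are natural. The two signs inside the bracket cancel; the one in the result remains. -/
lemma mlieBracket_rightInvariant [CompleteSpace E] (v w : GroupLieAlgebra I G) :
    mlieBracket I (rightInvariant v) (rightInvariant w) = rightInvariant (G := G) (-⁅v, w⁆) := by
  ext x
  have h := mfderiv_mlieBracket_of_related (inversion (I := I) (G := G))
    (mfderiv_inv_rightInvariant v) (mfderiv_inv_rightInvariant w)
    (mdifferentiable_mulInvariantVectorField _) (mdifferentiable_mulInvariantVectorField _) x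
  rw [← mulInvariantVector_mlieBracket, ← GroupLieAlgebra.bracket_def, neg_lie, lie_neg,
    neg_neg] at h
  have h' := mfderiv_inv_rightInvariant (I := I) (-⁅v, w⁆) x
  rw [neg_neg] at h'
  exact (mfderiv_diffeomorph_isInvertible (inversion (I := I) (G := G)) x).injective
    (h.trans h'.symm)

end LinearControl

/-! ### Left- and right-invariant fields commute. -/

namespace LinearControl

open VectorField Set Bundle Filter Topology

/-- The fields given by the two partial derivatives of a local group law commute at the unit. -/
lemma lieBracket_partial_fderiv_eq_zero {F : Type*} [NormedAddCommGroup F] [NormedSpace ℝ F]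
    {f : F × F → F} {e v w : F} (hf : ContDiffAt ℝ 2 f (e, e))
    (hv : fderiv ℝ f (e, e) (0, v) = v) (hw : fderiv ℝ f (e, e) (w, 0) = w) :
    lieBracket ℝ (fun x => fderiv ℝ f (x, e) (0, v)) (fun x => fderiv ℝ f (e, x) (w, 0)) e = 0 := by
  have hd : HasFDerivAt (fderiv ℝ f) (fderiv ℝ (fderiv ℝ f) (e, e)) (e, e) :=
    ((hf.fderiv_right (m := 1) (by norm_num)).differentiableAt (by simp)).hasFDerivAt
  have h1 : HasFDerivAt (fun x => fderiv ℝ f (x, e) (0, v)) _ e :=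
    (HasFDerivAt.comp (f := fun x : F => (x, e)) e hd
      ((hasFDerivAt_id e).prodMk (hasFDerivAt_const e e))).clm_apply
      (hasFDerivAt_const ((0 : F), v) e)
  have h2 : HasFDerivAt (fun x => fderiv ℝ f (e, x) (w, 0)) _ e :=
    (HasFDerivAt.comp (f := fun x : F => (e, x)) e hd
      ((hasFDerivAt_const e e).prodMk (hasFDerivAt_id e))).clm_apply
      (hasFDerivAt_const (w, (0 : F)) e)
  have hs := (hf.isSymmSndFDerivAt (by simp)) (0, v) (w, 0)
  rw [lieBracket, h1.fderiv, h2.fderiv, hv, hw]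
  simpa [sub_eq_zero] using hs

variable {E : Type*} [NormedAddCommGroup E] [NormedSpace ℝ E]
  {H : Type*} [TopologicalSpace H] {I : ModelWithCorners ℝ E H}
  {G : Type*} [TopologicalSpace G] [ChartedSpace H G] [Group G] [LieGroup I ∞ G]

variable (I G) in
/-- The multiplication read in the extended chart at the identity. -/
noncomputable def chartMul (p : E × E) : E :=
  extChartAt I (1 : G) ((extChartAt I (1 : G)).symm p.1 * (extChartAt I (1 : G)).symm p.2)

lemma contDiffAt_chartMul [I.Boundaryless] :
    ContDiffAt ℝ ∞ (chartMul I G) (extChartAt I (1 : G) 1, extChartAt I (1 : G) 1) := by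
  rw [← contMDiffAt_iff_contDiffAt]
  have hs : ContMDiffAt 𝓘(ℝ, E) I ∞ (extChartAt I (1 : G)).symm (extChartAt I (1 : G) 1) :=
    (contMDiffOn_extChartAt_symm (1 : G)).contMDiffAt (extChartAt_target_mem_nhds 1)
  have h1 : ContMDiffAt 𝓘(ℝ, E × E) I ∞ (fun p : E × E => (extChartAt I (1 : G)).symm p.1)
      (extChartAt I (1 : G) 1, extChartAt I (1 : G) 1) :=
    ContMDiffAt.comp (f := Prod.fst) _ hs contDiff_fst.contMDiff.contMDiffAt
  have h2 : ContMDiffAt 𝓘(ℝ, E × E) I ∞ (fun p : E × E => (extChartAt I (1 : G)).symm p.2)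
      (extChartAt I (1 : G) 1, extChartAt I (1 : G) 1) :=
    ContMDiffAt.comp (f := Prod.snd) _ hs contDiff_snd.contMDiff.contMDiffAt
  exact ContMDiffAt.comp_of_eq (y := (1 : G)) contMDiffAt_extChartAt (h1.mul h2) (by simp)

/-- A field read in the extended chart at the identity. -/
noncomputable def chartField (V : (g : G) → TangentSpace I g) (x : E) : E :=
  mpullbackWithin 𝓘(ℝ, E) I (extChartAt I (1 : G)).symm V (range I) x

lemma chartField_apply {V : (g : G) → TangentSpace I g} {x : E}
    (hx : x ∈ (extChartAt I (1 : G)).target) :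
    chartField V x =
      (mfderiv I 𝓘(ℝ, E) (extChartAt I (1 : G)) ((extChartAt I (1 : G)).symm x)
        (V ((extChartAt I (1 : G)).symm x)) : E) := by
  have : IsManifold I 1 G := IsManifold.of_le (n := ∞) (by simp)
  refine (isInvertible_mfderivWithin_extChartAt_symm hx).inverse_apply_eq.2 ?_
  exact (congrArg (fun L => L (V ((extChartAt I (1 : G)).symm x)))
    (mfderivWithin_extChartAt_symm_comp_mfderiv_extChartAt hx)).symm

lemma chartField_one (V : (g : G) → TangentSpace I g) :
    chartField V (extChartAt I (1 : G) 1) = (V 1 : E) := by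
  have : IsManifold I 1 G := IsManifold.of_le (n := ∞) (by simp)
  rw [chartField_apply (mem_extChartAt_target 1), extChartAt_to_inv, mfderiv_extChartAt_self]
  rfl

lemma hasFDerivAt_chart_comp [I.Boundaryless] {f : G → G} {g : G}
    (hf : MDifferentiableAt I I f 1) (hg : f 1 = g)
    (hs : g ∈ (extChartAt I (1 : G)).source) :
    HasFDerivAt (fun y => extChartAt I (1 : G) (f ((extChartAt I (1 : G)).symm y)))
      ((mfderiv I 𝓘(ℝ, E) (extChartAt I (1 : G)) g : E →L[ℝ] E) ∘L
        (mfderiv I I f 1 : E →L[ℝ] E))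
      (extChartAt I (1 : G) 1) := by
  have : IsManifold I 1 G := IsManifold.of_le (n := ∞) (by simp)
  subst hg
  -- The tangent space at `1` is identified with `E` through this very chart, so the derivative of
  -- its inverse there is the identity.
  have h1 : HasMFDerivAt 𝓘(ℝ, E) I (extChartAt I (1 : G)).symm (extChartAt I (1 : G) 1)
      (ContinuousLinearMap.id ℝ E) := by
    have h := (mdifferentiableWithinAt_extChartAt_symm
      (mem_extChartAt_target (I := I) (1 : G))).hasMFDerivWithinAt
    rw [mfderivWithin_range_extChartAt_symm, I.range_eq_univ] at h
    exact hasMFDerivWithinAt_univ.1 h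
  have h2 := (mdifferentiableAt_extChartAt (I := I) (x := (1 : G))
    (by rwa [extChartAt_source] at hs)).hasMFDerivAt
  have h3 : HasMFDerivAt I 𝓘(ℝ, E) (extChartAt I (1 : G) ∘ f)
      ((extChartAt I (1 : G)).symm (extChartAt I (1 : G) 1))
      ((mfderiv I 𝓘(ℝ, E) (extChartAt I (1 : G)) (f 1) : E →L[ℝ] E) ∘L
        (mfderiv I I f 1 : E →L[ℝ] E)) := by
    rw [extChartAt_to_inv]
    exact h2.comp (1 : G) hf.hasMFDerivAt
  exact (h3.comp (extChartAt I (1 : G) 1) h1).hasFDerivAt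

lemma eventually_differentiableAt_chartMul [I.Boundaryless] :
    ∀ᶠ p in 𝓝 (extChartAt I (1 : G) 1, extChartAt I (1 : G) 1),
      DifferentiableAt ℝ (chartMul I G) p := by
  filter_upwards [(contDiffAt_chartMul (I := I) (G := G)).of_le
    (show (1 : ℕ∞ω) ≤ ∞ by simp) |>.eventually (by simp)] with p hp
  exact hp.differentiableAt (by simp)

lemma chartField_rightInvariant [I.Boundaryless] (v : GroupLieAlgebra I G) :
    chartField (rightInvariant v) =ᶠ[𝓝 (extChartAt I (1 : G) 1)] fun x =>
      fderiv ℝ (chartMul I G) (extChartAt I (1 : G) 1, x) (v, 0) := by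
  have hc : ∀ᶠ x in 𝓝 (extChartAt I (1 : G) 1),
      DifferentiableAt ℝ (chartMul I G) (extChartAt I (1 : G) 1, x) :=
    (Continuous.prodMk_right _).continuousAt.eventually eventually_differentiableAt_chartMul
  filter_upwards [hc, extChartAt_target_mem_nhds (I := I) (1 : G)] with x hx hxt
  have h1 := HasFDerivAt.comp (f := fun y : E => (y, x)) (extChartAt I (1 : G) 1)
    hx.hasFDerivAt ((hasFDerivAt_id _).prodMk (hasFDerivAt_const x _))
  have h2 := hasFDerivAt_chart_comp (I := I)
    (mdifferentiableAt_mul_right ((extChartAt I (1 : G)).symm x) 1) (one_mul _)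
    ((extChartAt I (1 : G)).map_target hxt)
  rw [chartField_apply hxt]
  exact (congrArg (fun L : E →L[ℝ] E => L v) (h1.unique h2)).symm

lemma chartField_mulInvariantVectorField [I.Boundaryless] (v : GroupLieAlgebra I G) :
    chartField (mulInvariantVectorField v) =ᶠ[𝓝 (extChartAt I (1 : G) 1)] fun x =>
      fderiv ℝ (chartMul I G) (x, extChartAt I (1 : G) 1) (0, v) := by
  have hc : ∀ᶠ x in 𝓝 (extChartAt I (1 : G) 1),
      DifferentiableAt ℝ (chartMul I G) (x, extChartAt I (1 : G) 1) :=
    (Continuous.prodMk_left _).continuousAt.eventually eventually_differentiableAt_chartMul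
  filter_upwards [hc, extChartAt_target_mem_nhds (I := I) (1 : G)] with x hx hxt
  have h1 := HasFDerivAt.comp (f := fun y : E => (x, y)) (extChartAt I (1 : G) 1)
    hx.hasFDerivAt ((hasFDerivAt_const x _).prodMk (hasFDerivAt_id _))
  have h2 := hasFDerivAt_chart_comp (I := I)
    (mdifferentiableAt_mul_left ((extChartAt I (1 : G)).symm x) 1) (mul_one _)
    ((extChartAt I (1 : G)).map_target hxt)
  rw [chartField_apply hxt]
  exact (congrArg (fun L : E →L[ℝ] E => L v) (h1.unique h2)).symm

/-- Near the base point the fields read in the chart are the partial derivatives of `chartMul`, so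
this is the symmetry of its second derivative. -/
lemma mlieBracket_mulInvariantVectorField_rightInvariant_one [I.Boundaryless]
    (v w : GroupLieAlgebra I G) :
    mlieBracket I (mulInvariantVectorField v) (rightInvariant w) (1 : G) = 0 := by
  have hL := chartField_mulInvariantVectorField v
  have hR := chartField_rightInvariant w
  have key : lieBracketWithin ℝ (chartField (mulInvariantVectorField v))
      (chartField (rightInvariant w)) univ (extChartAt I (1 : G) 1) = 0 := by
    rw [lieBracketWithin_univ, hL.lieBracket_vectorField_eq hR]
    apply lieBracket_partial_fderiv_eq_zero (contDiffAt_chartMul.of_le ENat.LEInfty.out)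
    · rw [← hL.eq_of_nhds, chartField_one, mulInvariantVectorField_one]
    · rw [← hR.eq_of_nhds, chartField_one, rightInvariant_one]
  have hu : (extChartAt I (1 : G)).symm ⁻¹' univ ∩ range I = univ := by
    simp [I.range_eq_univ]
  rw [← mlieBracketWithin_univ, mlieBracketWithin_apply, hu]
  exact (congrArg (mfderiv I 𝓘(ℝ, E) (extChartAt I (1 : G)) 1).inverse key).trans (map_zero _)

/-- Left translation by `g⁻¹` moves the question to the identity: it preserves the left-invariant
field and keeps the other one right-invariant, with a new generator. -/
lemma mlieBracket_mulInvariantVectorField_rightInvariant [I.Boundaryless] [CompleteSpace E]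
    (v w : GroupLieAlgebra I G) :
    mlieBracket I (mulInvariantVectorField v) (rightInvariant w) = (0 : (g : G) → TangentSpace I g) := by
  ext g
  obtain ⟨w', hw⟩ := mfderiv_mul_left_rightInvariant (I := I) g⁻¹ w
  have h := mfderiv_mlieBracket_of_related (leftTranslation (I := I) (g⁻¹ : G))
    (mfderiv_mul_left_mulInvariantVectorField v g⁻¹) hw
    (mdifferentiable_mulInvariantVectorField _)
    ((contMDiff_rightInvariant w').mdifferentiable (by simp)) g
  have h1 : mlieBracket I (mulInvariantVectorField v) (rightInvariant w')
      (leftTranslation (I := I) (g⁻¹ : G) g) = 0 := by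
    have : leftTranslation (I := I) (g⁻¹ : G) g = 1 := inv_mul_cancel g
    rw [this, mlieBracket_mulInvariantVectorField_rightInvariant_one]
  rw [h1] at h
  exact (mfderiv_diffeomorph_isInvertible (leftTranslation (I := I) (g⁻¹ : G)) g).injective
    (h.trans (map_zero _).symm)

end LinearControl

/-! ### The exponential map and integral curves of sums of invariant fields. -/

namespace LinearControl

open VectorField Set Bundle Filter Topology

variable {E : Type*} [NormedAddCommGroup E] [NormedSpace ℝ E] [CompleteSpace E]
  {H : Type*} [TopologicalSpace H] {I : ModelWithCorners ℝ E H} [I.Boundaryless]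
  {G : Type*} [TopologicalSpace G] [ChartedSpace H G] [Group G] [LieGroup I ∞ G] [T2Space G]

/-- Right translates of one local curve through `1` are integral curves, so the existence time `ε`
is the same at every point and the field is complete. -/
lemma exists_isMIntegralCurve_rightInvariant (v : GroupLieAlgebra I G) :
    ∃ γ : ℝ → G, γ 0 = 1 ∧ IsMIntegralCurve γ (rightInvariant v) := by
  have : IsManifold I 1 G := IsManifold.of_le (n := ∞) (by simp)
  have hv : ContMDiff I I.tangent 1 (fun g : G => (⟨g, rightInvariant v g⟩ : TangentBundle I G)) :=
    (contMDiff_rightInvariant v).of_le (by simp)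
  obtain ⟨γ, h0, hγ⟩ := exists_isMIntegralCurveAt_of_contMDiffAt_boundaryless 0
    (hv.contMDiffAt (x := 1))
  obtain ⟨ε, hε, hγ⟩ := isMIntegralCurveAt_iff'.1 hγ
  rw [Real.ball_zero_eq_Ioo] at hγ
  refine exists_isMIntegralCurve_of_isMIntegralCurveOn hv hε (fun x => ?_) 1
  refine ⟨fun t => γ t * x, by simp [h0], fun t ht => ?_⟩
  have h := ((hγ t ht).hasMFDerivAt (isOpen_Ioo.mem_nhds ht))
  have h' := hasMFDerivAt_comp_curve h (mdifferentiableAt_mul_right x (γ t))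
  rw [mfderiv_mul_right_rightInvariant] at h'
  exact h'.hasMFDerivWithinAt

omit [CompleteSpace E] in
lemma isMIntegralCurve_rightInvariant_unique {v : GroupLieAlgebra I G} {γ γ' : ℝ → G}
    (hγ : IsMIntegralCurve γ (rightInvariant v)) (hγ' : IsMIntegralCurve γ' (rightInvariant v))
    {t : ℝ} (h : γ t = γ' t) : γ = γ' := by
  have : IsManifold I 1 G := IsManifold.of_le (n := ∞) (by simp)
  exact isMIntegralCurve_Ioo_eq_of_contMDiff_boundaryless
    ((contMDiff_rightInvariant v).of_le (by simp)) hγ hγ' h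

omit [CompleteSpace E] in
lemma lieExp_eq {v : GroupLieAlgebra I G} {γ : ℝ → G} (h0 : γ 0 = 1)
    (hγ : IsMIntegralCurve γ (rightInvariant v)) : lieExp v = γ 1 := by
  have h := Classical.epsilon_spec (p := fun γ : ℝ → G => γ 0 = 1 ∧
    IsMIntegralCurve γ (rightInvariant v)) ⟨γ, h0, hγ⟩
  exact congrFun (isMIntegralCurve_rightInvariant_unique h.2 hγ (h.1.trans h0.symm)) 1

omit [CompleteSpace E] in
lemma lieExp_smul_eq {v : GroupLieAlgebra I G} {γ : ℝ → G} (h0 : γ 0 = 1)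
    (hγ : IsMIntegralCurve γ (rightInvariant v)) (t : ℝ) : lieExp (t • v) = γ t := by
  have h := hγ.comp_mul t
  rw [← rightInvariant_smul] at h
  rw [lieExp_eq (by simpa using h0) h]
  simp

lemma isMIntegralCurve_lieExp (v : GroupLieAlgebra I G) :
    IsMIntegralCurve (fun t : ℝ => (lieExp (t • v) : G)) (rightInvariant v) := by
  obtain ⟨γ, h0, hγ⟩ := exists_isMIntegralCurve_rightInvariant v
  simpa only [lieExp_smul_eq h0 hγ] using hγ

lemma lieExp_zero : lieExp (0 : GroupLieAlgebra I G) = 1 := by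
  obtain ⟨γ, h0, hγ⟩ := exists_isMIntegralCurve_rightInvariant (0 : GroupLieAlgebra I G)
  rw [← smul_zero (0 : ℝ), lieExp_smul_eq h0 hγ 0, h0]

lemma lieExp_add_smul (v : GroupLieAlgebra I G) (s t : ℝ) :
    (lieExp ((s + t) • v) : G) = lieExp (s • v) * lieExp (t • v) := by
  have h1 := (isMIntegralCurve_lieExp v).comp_add t
  have h2 : IsMIntegralCurve (fun s : ℝ => (lieExp (s • v) : G) * lieExp (t • v))
      (rightInvariant v) := fun r => by
    have h := hasMFDerivAt_comp_curve (isMIntegralCurve_lieExp v r)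
      (mdifferentiableAt_mul_right (lieExp (t • v)) _)
    rwa [mfderiv_mul_right_rightInvariant] at h
  exact congrFun (isMIntegralCurve_rightInvariant_unique h1 h2 (t := 0)
    (by simp [lieExp_zero])) s

/-- Along a one-parameter subgroup its right- and left-invariant generators agree. -/
lemma rightInvariant_lieExp (v : GroupLieAlgebra I G) (t : ℝ) :
    rightInvariant v (lieExp (t • v) : G) = mulInvariantVectorField v (lieExp (t • v)) := by
  have h1 := (isMIntegralCurve_lieExp v).comp_add t 0
  have h2 := hasMFDerivAt_comp_curve (isMIntegralCurve_lieExp v 0)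
    (mdifferentiableAt_mul_left (lieExp (t • v)) _)
  -- The shifted curve is also a left translate of the original; its velocity at `s = 0` is computed
  -- in both ways.
  have e : (fun s : ℝ => (lieExp (s • v) : G)) ∘ (fun s => s + t) =
      fun s : ℝ => lieExp (t • v) * lieExp (s • v) := by
    ext s
    simp only [Function.comp_apply]
    rw [add_comm, lieExp_add_smul]
  rw [e] at h1
  have h3 := congrArg (fun L : ℝ →L[ℝ] E => L 1) (hasMFDerivAt_unique h1 h2)
  -- The point `lieExp (0 • v)` equals `1` only propositionally; it becomes a variable so that
  -- `subst` can carry the tangent vectors along.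
  have key (p q : G) (hq : q = 1)
      (h : (rightInvariant v (p * q) : E) = mfderiv I I (fun x => p * x) q (rightInvariant v q)) :
      rightInvariant v p = mulInvariantVectorField v p := by
    subst hq
    rwa [rightInvariant_one, mul_one] at h
  refine key (lieExp (t • v)) (lieExp ((0 : ℝ) • v)) (by rw [zero_smul, lieExp_zero]) ?_
  exact (one_smul ℝ _).symm.trans (h3.trans (one_smul ℝ _))

/-- In the product rule the left factor is differentiated with its right-invariant generator and the
right factor with its left-invariant one, so that the remaining translations preserve both. -/
lemma isMIntegralCurve_mul_mul (A B : GroupLieAlgebra I G) (g : G) :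
    IsMIntegralCurve (fun t : ℝ => lieExp (t • A) * g * lieExp (t • B))
      (rightInvariant A + mulInvariantVectorField B) := fun t => by
  have hb := isMIntegralCurve_lieExp B t
  simp only [rightInvariant_lieExp] at hb
  have ha := hasMFDerivAt_comp_curve (isMIntegralCurve_lieExp A t)
    (mdifferentiableAt_mul_right g _)
  rw [mfderiv_mul_right_rightInvariant] at ha
  have h := hasMFDerivAt_mul_curve ha hb
  rw [mfderiv_mul_right_rightInvariant, mfderiv_mul_left_mulInvariantVectorField] at h
  exact h

omit [CompleteSpace E] [I.Boundaryless] [T2Space G] in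
lemma contMDiff_rightInvariant_add_mulInvariantVectorField (A B : GroupLieAlgebra I G) :
    ContMDiff I I.tangent ∞ (fun g : G => (⟨g, (rightInvariant A + mulInvariantVectorField B :
      (g : G) → TangentSpace I g) g⟩ : TangentBundle I G)) :=
  (contMDiff_rightInvariant A).add_section (contMDiff_mulInvariantVectorField_top B)

lemma eqOn_of_isMIntegralCurveOn_Ioo {A B : GroupLieAlgebra I G} {γ : ℝ → G} {T : ℝ}
    (hc : ContinuousOn γ (Icc 0 T))
    (hγ : IsMIntegralCurveOn γ (rightInvariant A + mulInvariantVectorField B) (Ioo 0 T)) :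
    EqOn γ (fun t => lieExp (t • A) * γ 0 * lieExp (t • B)) (Icc 0 T) := by
  have : IsManifold I 1 G := IsManifold.of_le (n := ∞) (by simp)
  rcases lt_or_ge 0 T with hT | hT
  swap
  · intro t ht
    obtain rfl : t = 0 := le_antisymm (ht.2.trans hT) ht.1
    simp [lieExp_zero]
  -- Uniqueness is available on the open interval and needs an interior base time. The identity then
  -- passes to the end points by continuity, and the base is moved back to `0`.
  set a := T / 2 with ha
  have hσ := (isMIntegralCurve_mul_mul A B (γ a)).comp_add (-a)
  have hσa : γ a = ((fun t : ℝ => lieExp (t • A) * γ a * lieExp (t • B)) ∘ (· + -a)) a := by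
    simp [lieExp_zero]
  have h1 := isMIntegralCurveOn_Ioo_eqOn_of_contMDiff_boundaryless
    (show a ∈ Ioo 0 T from ⟨by linarith, by linarith⟩)
    ((contMDiff_rightInvariant_add_mulInvariantVectorField A B).of_le (by simp)) hγ
    (hσ.isMIntegralCurveOn _) hσa
  have h2 := h1.of_subset_closure hc hσ.continuous.continuousOn Ioo_subset_Icc_self
    (by rw [closure_Ioo hT.ne])
  have e0 := h2 (left_mem_Icc.2 hT.le)
  intro t ht
  rw [h2 ht, e0]
  have hA := lieExp_add_smul A (t + -a) (0 + a)
  have hA' := lieExp_add_smul A (0 + a) (0 + -a)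
  have hB := lieExp_add_smul B (0 + a) (t + -a)
  have hB' := lieExp_add_smul B (0 + -a) (0 + a)
  rw [show t + -a + (0 + a) = t by ring] at hA
  rw [show 0 + a + (t + -a) = t by ring] at hB
  rw [show 0 + a + (0 + -a) = (0 : ℝ) by ring, zero_smul, lieExp_zero] at hA'
  rw [show 0 + -a + (0 + a) = (0 : ℝ) by ring, zero_smul, lieExp_zero] at hB'
  simp only [Function.comp_apply, hA, hB]
  rw [eq_inv_of_mul_eq_one_right hA'.symm, eq_inv_of_mul_eq_one_left hB'.symm]
  group

end LinearControl

/-! ### Fields commuting with all right-invariant fields. -/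

namespace LinearControl

open VectorField Set Bundle Filter Topology

/-- A function with vanishing differential on a connected manifold is constant. -/
lemma eq_of_mfderiv_eq_zero {E : Type*} [NormedAddCommGroup E] [NormedSpace ℝ E]
    {H : Type*} [TopologicalSpace H] {I : ModelWithCorners ℝ E H} [I.Boundaryless]
    {M : Type*} [TopologicalSpace M] [ChartedSpace H M] [IsManifold I 1 M] [PreconnectedSpace M]
    {f : M → ℝ} (hf : MDifferentiable I 𝓘(ℝ, ℝ) f)
    (h : ∀ x v, (mfderiv I 𝓘(ℝ, ℝ) f x v : ℝ) = 0) (x y : M) : f x = f y := by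
  have hl : IsLocallyConstant f := by
    refine (IsLocallyConstant.iff_eventually_eq f).2 fun x => ?_
    obtain ⟨ε, hε, hball⟩ := Metric.isOpen_iff.1 (isOpen_extChartAt_target (I := I) x) _
      (mem_extChartAt_target x)
    have hd : ∀ y ∈ Metric.ball (extChartAt I x x) ε,
        HasFDerivAt (f ∘ (extChartAt I x).symm) (0 : E →L[ℝ] ℝ) y := fun y hy => by
      have h1 := (mdifferentiableWithinAt_extChartAt_symm (hball hy)).mdifferentiableAt
        (by simp [I.range_eq_univ])
      have h2 := ((hf _).hasMFDerivAt.comp y h1.hasMFDerivAt).hasFDerivAt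
      have h3 : (0 : E →L[ℝ] ℝ) = (mfderiv I 𝓘(ℝ, ℝ) f ((extChartAt I x).symm y)).comp
          (mfderiv 𝓘(ℝ, E) I (extChartAt I x).symm y) := by
        ext v
        exact (h _ _).symm
      rw [h3]
      exact h2
    have hc {z : E} (hz : z ∈ Metric.ball (extChartAt I x x) ε) := Metric.isOpen_ball.is_const_of_fderiv_eq_zero
      (Metric.isPreconnected_ball (x := extChartAt I x x) (r := ε))
      (fun y hy => (hd y hy).differentiableAt.differentiableWithinAt)
      (fun y hy => (hd y hy).fderiv) hz (Metric.mem_ball_self hε)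
    filter_upwards [extChartAt_source_mem_nhds (I := I) x,
      (continuousAt_extChartAt (I := I) x).preimage_mem_nhds (Metric.ball_mem_nhds _ hε)]
      with z hz hz'
    have h := hc hz'
    rwa [Function.comp_apply, Function.comp_apply, (extChartAt I x).left_inv hz,
      extChartAt_to_inv] at h
  exact hl.apply_eq_of_preconnectedSpace x y

variable {E : Type*} [NormedAddCommGroup E] [NormedSpace ℝ E]
  {H : Type*} [TopologicalSpace H] {I : ModelWithCorners ℝ E H}
  {G : Type*} [TopologicalSpace G] [ChartedSpace H G] [Group G] [LieGroup I ∞ G]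

/-- The value at `g` of a vector field, moved to the identity by a left translation. -/
noncomputable def leftCoeff (V : (g : G) → TangentSpace I g) (g : G) :
    GroupLieAlgebra I G :=
  (mfderiv I I (fun x => g⁻¹ * x) g (V g) : E)

lemma mulInvariantVectorField_leftCoeff (V : (g : G) → TangentSpace I g) (g : G) :
    mulInvariantVectorField (leftCoeff V g) g = V g := by
  have h := mfderiv_comp_apply_of_eq (I' := I) (x := g) (y := (1 : G))
    (f := fun x : G => g⁻¹ * x) (g := fun x : G => g * x)
    (mdifferentiableAt_mul_left g 1) (mdifferentiableAt_mul_left g⁻¹ g) (inv_mul_cancel g) (V g)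
  have e : (fun x : G => g * x) ∘ (fun x => g⁻¹ * x) = id := by ext; simp
  rw [e, mfderiv_id] at h
  exact h.symm

omit [LieGroup I ∞ G] in
lemma trivializationAt_one_apply [IsManifold I 1 G] (v : GroupLieAlgebra I G) :
    (trivializationAt E (TangentSpace I) (1 : G) ⟨1, v⟩).2 = (v : E) := by
  rw [TangentBundle.trivializationAt_apply]
  exact (congrArg (fun D : E →L[ℝ] E => D v)
    (fderivWithin_extChartAt_comp_extChartAt_symm_range (I := I) (x := (1 : G))))

/-- The tangent map of the multiplication, applied to the zero vector at `g⁻¹` and to `V g`, lands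
in the fibre over `1`, where the trivialization is the identity. -/
lemma contMDiff_leftCoeff {V : (g : G) → TangentSpace I g}
    (hV : ContMDiff I I.tangent ∞ (fun g => (⟨g, V g⟩ : TangentBundle I G))) :
    ContMDiff (M' := E) I 𝓘(ℝ, E) ∞ (leftCoeff V) := by
  have : IsManifold I 1 G := IsManifold.of_le (n := ∞) (by simp)
  have h := contMDiff_tangent_mul (I := I) (A := fun g : G => ⟨g⁻¹, 0⟩) (B := fun g => ⟨g, V g⟩)
    ((contMDiff_zeroSection ℝ (TangentSpace I)).comp (contMDiff_inv I ∞)) hV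
  have h' : ContMDiff I I.tangent ∞
      (fun g : G => (⟨1, leftCoeff V g⟩ : TangentBundle I G)) := by
    refine h.congr fun g => ?_
    have h0 : mfderiv I I (fun x => x * g) g⁻¹ (0 : TangentSpace I g⁻¹) = 0 := map_zero _
    ext
    · simp
    · simp only [h0, leftCoeff, zero_add]
      exact HEq.rfl
  intro g
  have h2 := (contMDiffAt_totalSpace.1 (h' g)).2
  refine h2.congr_of_eventuallyEq (Eventually.of_forall fun x => (trivializationAt_one_apply _).symm)

variable [FiniteDimensional ℝ E]

lemma mlieBracket_sum_smul_right {ι : Type*} (s : Finset ι) {M : Type*} [TopologicalSpace M]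
    [ChartedSpace H M] [IsManifold I ∞ M] {V : (x : M) → TangentSpace I x}
    {f : ι → M → ℝ} {W : ι → (x : M) → TangentSpace I x}
    (hf : ∀ i, ContMDiff I 𝓘(ℝ, ℝ) ∞ (f i))
    (hW : ∀ i, ContMDiff I I.tangent ∞ (fun x => (⟨x, W i x⟩ : TangentBundle I M))) (x : M) :
    mlieBracket I V (∑ i ∈ s, f i • W i) x =
      ∑ i ∈ s, (mvfderiv I (f i) x (V x) • W i x + f i x • mlieBracket I V (W i) x) := by
  have : IsManifold I 1 M := IsManifold.of_le (n := ∞) (by simp)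
  have : IsManifold I 2 M := IsManifold.of_le (n := ∞) ENat.LEInfty.out
  classical
  induction s using Finset.induction_on with
  | empty => simp
  | insert i s hi ih =>
    have h1 := ((hf i).smul_section (hW i)).mdifferentiable (by simp) x
    have h2 : MDifferentiableAt I I.tangent
        (fun x => (⟨x, (∑ i ∈ s, f i • W i) x⟩ : TangentBundle I M)) x := by
      have := (ContMDiff.sum_section (s := s) (t := fun i => f i • W i)
        (fun i _ => (hf i).smul_section (hW i))).mdifferentiable (by simp) x
      simpa using this
    rw [Finset.sum_insert hi, Finset.sum_insert hi, mlieBracket_add_right h1 h2, ih,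
      mlieBracket_smul_right ((hf i).mdifferentiable (by simp) x)
        ((hW i).mdifferentiable (by simp) x)]

/-- On a connected group, a field commuting with the right-invariant fields is left-invariant. -/
lemma eq_mulInvariantVectorField_of_commute [I.Boundaryless] [ConnectedSpace G]
    {Z : (g : G) → TangentSpace I g}
    (hZ : ContMDiff I I.tangent ∞ (fun g => (⟨g, Z g⟩ : TangentBundle I G)))
    (hc : ∀ v : GroupLieAlgebra I G, mlieBracket I (rightInvariant v) Z = 0) :
    Z = mulInvariantVectorField (Z 1) := by
  have : IsManifold I 1 G := IsManifold.of_le (n := ∞) (by simp)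
  have : CompleteSpace E := FiniteDimensional.complete ℝ E
  let b := Module.finBasis ℝ E
  let f (i : Fin (Module.finrank ℝ E)) (g : G) : ℝ := b.coord i (leftCoeff Z g)
  have hf (i) : ContMDiff I 𝓘(ℝ, ℝ) ∞ (f i) :=
    (LinearMap.toContinuousLinearMap (b.coord i)).contMDiff.comp (contMDiff_leftCoeff hZ)
  let L (i : Fin (Module.finrank ℝ E)) : (g : G) → TangentSpace I g :=
    mulInvariantVectorField (b i : GroupLieAlgebra I G)
  have lin (c : Fin (Module.finrank ℝ E) → ℝ) (g : G) :
      ∑ i, c i • L i g = mfderiv I I (fun x : G => g * x) 1 (∑ i, c i • b i : E) := by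
    let D : E →L[ℝ] E := mfderiv I I (fun x : G => g * x) 1
    change (∑ i, c i • D (b i) : E) = D (∑ i, c i • b i)
    simp
  have hsum : Z = ∑ i, f i • L i := by
    ext g
    rw [← mulInvariantVectorField_leftCoeff Z g, Finset.sum_apply]
    refine Eq.trans ?_ (lin (fun i => f i g) g).symm
    rw [mulInvariantVectorField]
    exact congrArg _ (b.sum_repr (leftCoeff Z g)).symm
  have hzero (i) (g : G) (v : TangentSpace I g) : (mfderiv I 𝓘(ℝ, ℝ) (f i) g v : ℝ) = 0 := by
    -- Right-invariant fields fill each tangent space, so testing the differential on them suffices.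
    obtain ⟨w, rfl⟩ : ∃ w : GroupLieAlgebra I G, rightInvariant w g = v := by
      have h := (mfderiv_diffeomorph_isInvertible (rightTranslation (I := I) g) 1).surjective
      have key (q : G) (hq : q = g) (u : E) : ∃ w : GroupLieAlgebra I G,
          (mfderiv I I (rightTranslation (I := I) g) 1 w : E) = u := h u
      exact key g rfl v
    have h1 := congrFun (hc w) g
    rw [hsum, mlieBracket_sum_smul_right (W := L) _ hf
      (fun i => contMDiff_mulInvariantVectorField_top (b i : GroupLieAlgebra I G))] at h1
    -- In the Leibniz expansion of the bracket, the terms with brackets of invariant fields vanish;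
    -- only derivatives of the coefficients survive.
    have h2 : ∑ i, mvfderiv I (f i) g (rightInvariant w g) • L i g = 0 := by
      refine Eq.trans (Finset.sum_congr rfl fun i _ => ?_) h1
      have hcomm : mlieBracket I (rightInvariant w) (L i) = 0 := by
        rw [mlieBracket_swap]
        exact neg_eq_zero.2 (mlieBracket_mulInvariantVectorField_rightInvariant _ _)
      rw [hcomm, Pi.zero_apply, smul_zero, add_zero]
    rw [lin] at h2
    have h3 := (mfderiv_diffeomorph_isInvertible (leftTranslation (I := I) g) 1).injective
      (h2.trans (map_zero (mfderiv I I (leftTranslation (I := I) g) 1)).symm)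
    exact Fintype.linearIndependent_iff.1 b.linearIndependent _ h3 i
  have hconst : ∀ g, leftCoeff Z g = leftCoeff Z 1 := fun g => by
    refine b.ext_elem fun i => ?_
    exact eq_of_mfderiv_eq_zero ((hf i).mdifferentiable (by simp)) (hzero i) g 1
  ext g
  rw [← mulInvariantVectorField_leftCoeff Z g, hconst]
  congr 1
  rw [← mulInvariantVectorField_one (leftCoeff Z 1),
    mulInvariantVectorField_leftCoeff]

end LinearControl

/-! ### Linear vector fields and inner derivations. -/

namespace LinearControl

open VectorField Set Bundle Filter Topology

variable {E : Type*} [NormedAddCommGroup E] [NormedSpace ℝ E]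
  {H : Type*} [TopologicalSpace H] {I : ModelWithCorners ℝ E H}
  {G : Type*} [TopologicalSpace G] [ChartedSpace H G] [Group G]

lemma rightInvariant_sum_smul {ι : Type*} (s : Finset ι) (c : ι → ℝ)
    (Y : ι → GroupLieAlgebra I G) (g : G) :
    rightInvariant (∑ j ∈ s, c j • Y j) g = ∑ j ∈ s, c j • rightInvariant (Y j) g := by
  let D : E →L[ℝ] E := mfderiv I I (fun x : G => x * g) 1
  exact (map_sum D _ s).trans (Finset.sum_congr rfl fun j _ => D.map_smul (c j) (Y j))

variable [LieGroup I ∞ G] {V : (g : G) → TangentSpace I g}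

lemma IsLinearVectorField.mdifferentiable (hV : IsLinearVectorField V) :
    MDifferentiable I I.tangent (fun g => (⟨g, V g⟩ : TangentBundle I G)) :=
  hV.smooth.mdifferentiable (by simp)

/-- A linear vector field is an infinitesimal automorphism. -/
lemma IsLinearVectorField.apply_mul (hV : IsLinearVectorField V) (g h : G) :
    V (g * h) = mfderiv I I (fun x => x * h) g (V g) + mfderiv I I (fun x => g * x) h (V h) := by
  obtain ⟨φ, hφ, -, -⟩ := hV.exists_flow
  have h1 := hφ.isMIntegralCurve (g * h) 0
  have h2 := hasMFDerivAt_mul_curve (hφ.isMIntegralCurve g 0) (hφ.isMIntegralCurve h 0)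
  have e : (fun t => φ t (g * h)) = fun t => φ t g * φ t h := funext fun t => map_mul (φ t) g h
  rw [e] at h1
  have h3 := congrArg (fun L : ℝ →L[ℝ] E => L 1) (hasMFDerivAt_unique h1 h2)
  have h4 := (one_smul ℝ _).symm.trans (h3.trans (one_smul ℝ _))
  have key (a b : G) (ha : a = g) (hb : b = h) (hab : (V (a * b) : E) =
      (mfderiv I I (fun x => x * b) a (V a) + mfderiv I I (fun x => a * x) b (V b) : E)) :
      (V (g * h) : E) =
      (mfderiv I I (fun x => x * h) g (V g) + mfderiv I I (fun x => g * x) h (V h) : E) := by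
    subst ha hb
    exact hab
  exact key _ _ (hφ.map_zero g) (hφ.map_zero h) h4

/-- The product formula at `1 * 1` reads `V 1 = V 1 + V 1`. -/
lemma IsLinearVectorField.apply_one (hV : IsLinearVectorField V) : V 1 = 0 := by
  have h := hV.apply_mul 1 1
  have e1 := mfderiv_mul_right_of_eq_one (I := I) (rfl : (1 : G) = 1) 1 (V 1)
  have e2 := mfderiv_mul_left_of_eq_one (I := I) (rfl : (1 : G) = 1) 1 (V 1)
  have key (a : G) (ha : a = 1) (h : (V a : E) = (V 1 + V 1 : E)) : (V 1 : E) = 0 := by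
    subst ha
    exact left_eq_add.1 h
  exact key (1 * 1) (one_mul 1) (h.trans (congrArg₂ (fun a b : E => a + b) e1 e2))

variable [I.Boundaryless] [FiniteDimensional ℝ E]

/-- The bracket of a linear vector field and a right-invariant field is right-invariant. -/
lemma IsLinearVectorField.mlieBracket_rightInvariant (hV : IsLinearVectorField V)
    (Y : GroupLieAlgebra I G) :
    mlieBracket I V (rightInvariant Y) =
      rightInvariant (mlieBracket I V (rightInvariant Y) (1 : G)) := by
  have : IsManifold I 1 G := IsManifold.of_le (n := ∞) (by simp)
  have : CompleteSpace E := FiniteDimensional.complete ℝ E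
  ext h
  -- Right translation by `h` changes `V` only by the left-invariant field of `-w`, which does not
  -- affect brackets with right-invariant fields.
  set w : GroupLieAlgebra I G := leftCoeff V h
  have hw : ∀ g, mfderiv I I (rightTranslation (I := I) h) g (V g) =
      (V + mulInvariantVectorField (-w)) (rightTranslation (I := I) h g) := fun g => by
    have h1 := hV.apply_mul g h
    rw [← mulInvariantVectorField_leftCoeff V h, mfderiv_mul_left_mulInvariantVectorField] at h1
    have h2 : mulInvariantVectorField (-w) (g * h) = -mulInvariantVectorField w (g * h) :=
      map_neg _ w
    change mfderiv I I (fun x => x * h) g (V g) = V (g * h) + mulInvariantVectorField (-w) (g * h)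
    rw [h1, h2, add_neg_cancel_right]
  have hs := mdifferentiable_mulInvariantVectorField (I := I) (G := G) (-w)
  have hR := (contMDiff_rightInvariant (I := I) (G := G) Y).mdifferentiable (by simp)
  have h1 := mfderiv_mlieBracket_of_related (rightTranslation (I := I) h) hw
    (fun g => mfderiv_mul_right_rightInvariant Y g h)
    (hV.smooth.add_section (contMDiff_mulInvariantVectorField_top (-w)) |>.mdifferentiable
      (by simp)) hR 1
  rw [mlieBracket_add_left (hV.mdifferentiable _) (hs _),
    mlieBracket_mulInvariantVectorField_rightInvariant, Pi.zero_apply, add_zero] at h1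
  have key (q : G) (hq : q = h) (h1 : (mfderiv I I (rightTranslation (I := I) h) 1
      (mlieBracket I V (rightInvariant Y) 1) : E) = mlieBracket I V (rightInvariant Y) q) :
      mlieBracket I V (rightInvariant Y) h =
        rightInvariant (mlieBracket I V (rightInvariant Y) 1) h := by
    subst hq
    exact h1.symm
  exact key _ (one_mul h) h1

/-- The derivation of the Lie algebra of the group given by the bracket with a linear field. -/
noncomputable def bracketDerivation [CompleteSpace E] (hV : IsLinearVectorField V) :
    LieDerivation ℝ (GroupLieAlgebra I G) (GroupLieAlgebra I G) where
  toFun Y := mlieBracket I V (rightInvariant Y) 1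
  map_add' Y Y' := by
    rw [rightInvariant_add, mlieBracket_add_right] <;>
      exact (contMDiff_rightInvariant _).mdifferentiable (by simp) 1
  map_smul' c Y := by
    rw [rightInvariant_smul, mlieBracket_const_smul_right]
    · rfl
    · exact (contMDiff_rightInvariant _).mdifferentiable (by simp) 1
  leibniz' a b := by
    have hle : minSmoothness ℝ 2 ≤ ∞ := by
      rw [minSmoothness_of_isRCLikeNormedField]
      exact ENat.LEInfty.out
    -- The derivation rule is the Jacobi identity for fields, evaluated at `1`; every bracket of
    -- right-invariant fields contributes the same sign, which cancels.
    have h1 := leibniz_identity_mlieBracket (hV.smooth.of_le hle)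
      ((contMDiff_rightInvariant a).of_le hle) ((contMDiff_rightInvariant b).of_le hle)
    rw [LinearControl.mlieBracket_rightInvariant, hV.mlieBracket_rightInvariant a,
      hV.mlieBracket_rightInvariant b, LinearControl.mlieBracket_rightInvariant,
      LinearControl.mlieBracket_rightInvariant, ← rightInvariant_add,
      ← neg_one_smul ℝ, rightInvariant_smul] at h1
    have h2 := congrFun h1 1
    rw [mlieBracket_const_smul_right
      ((contMDiff_rightInvariant _).mdifferentiable (by simp) 1), rightInvariant_one] at h2
    change mlieBracket I V (rightInvariant ⁅a, b⁆) 1 =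
      ⁅a, mlieBracket I V (rightInvariant b) 1⁆ - ⁅b, mlieBracket I V (rightInvariant a) 1⁆
    rw [neg_one_smul, ← neg_add, neg_inj] at h2
    rw [h2, ← lie_skew b, sub_neg_eq_add, add_comm]

lemma exists_isInnerBy [CompleteSpace E] (hV : IsLinearVectorField V)
    [LieAlgebra.HasTrivialRadical ℝ (GroupLieAlgebra I G)] :
    ∃ X : GroupLieAlgebra I G, IsInnerBy V X := by
  have : Module.Finite ℝ (GroupLieAlgebra I G) := inferInstanceAs (Module.Finite ℝ E)
  obtain ⟨x, hx⟩ := LieDerivation.IsKilling.exists_eq_ad (bracketDerivation hV)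
  -- The sign compensates for the bracket of right-invariant fields being the negative of the
  -- bracket of `GroupLieAlgebra I G`.
  refine ⟨-x, fun Y => ?_⟩
  have h := congrArg (fun D => D Y) hx
  have h' : mlieBracket I V (rightInvariant Y) 1 = ⁅x, Y⁆ :=
    h.symm.trans (LieDerivation.ad_apply_apply ℝ _ x Y)
  rw [derivationOf, hV.mlieBracket_rightInvariant, h', mlieBracket_rightInvariant, neg_lie, neg_neg]

/-- A linear vector field with inner derivation is the sum of a right-invariant field and of a
left-invariant one. -/
lemma IsInnerBy.eq_add [ConnectedSpace G] (hV : IsLinearVectorField V) {X : GroupLieAlgebra I G}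
    (hX : IsInnerBy V X) : V = rightInvariant X + mulInvariantVectorField (-X) := by
  have : IsManifold I 1 G := IsManifold.of_le (n := ∞) (by simp)
  have hR (Y : GroupLieAlgebra I G) := (contMDiff_rightInvariant Y).mdifferentiable (by simp)
  have h := eq_mulInvariantVectorField_of_commute (Z := V + (-1 : ℝ) • rightInvariant X)
    (hV.smooth.add_section ((contMDiff_rightInvariant X).const_smul_section)) fun Y => by
      ext g
      have h1 : mlieBracket I V (rightInvariant Y) =
        mlieBracket I (rightInvariant X) (rightInvariant Y) := neg_injective (hX Y)
      rw [mlieBracket_add_right (hV.mdifferentiable g)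
        ((contMDiff_rightInvariant X).const_smul_section.mdifferentiable (by simp) g),
        mlieBracket_const_smul_right (hR X g), mlieBracket_swap (V := rightInvariant Y),
        h1, mlieBracket_swap (V := rightInvariant Y)]
      simp
  have h1 : (V + (-1 : ℝ) • rightInvariant X : (g : G) → TangentSpace I g) 1 = (-X : E) := by
    rw [Pi.add_apply, Pi.smul_apply, hV.apply_one, rightInvariant_one, zero_add, neg_one_smul]
  rw [h1] at h
  rw [← h]
  simp

end LinearControl

/-! ### The decomposition, the flow and the controlled trajectories. -/

theorem theorem5p1 {E : Type*} [NormedAddCommGroup E] [NormedSpace ℝ E] [FiniteDimensional ℝ E]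
    {H : Type*} [TopologicalSpace H] (I : ModelWithCorners ℝ E H) [I.Boundaryless]
    {G : Type*} [TopologicalSpace G] [ChartedSpace H G] [Group G] [LieGroup I ∞ G]
    [T2Space G] [ConnectedSpace G]
    (𝒳 : (g : G) → TangentSpace I g) (h𝒳 : LinearControl.IsLinearVectorField 𝒳) :
    (∀ X : GroupLieAlgebra I G, LinearControl.IsInnerBy 𝒳 X →
      𝒳 = LinearControl.rightInvariant X +
          LinearControl.inversionField (LinearControl.rightInvariant X) ∧
      (∀ φ : ℝ → G → G, LinearControl.IsFlow 𝒳 φ → ∀ (t : ℝ) (g : G),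
        φ t g = LinearControl.lieExp (t • X) * g * LinearControl.lieExp (-(t • X))) ∧
      ∀ (m : ℕ) (Y : Fin m → GroupLieAlgebra I G) (u : ℝ → Fin m → ℝ),
        LinearControl.IsPiecewiseConstant u →
        ∀ (T : ℝ), 0 ≤ T → ∀ c : Fin m → ℝ, (∀ t ∈ Set.Icc 0 T, u t = c) →
          LinearControl.IsSolutionOn 𝒳 Y u 1
            (fun t => LinearControl.lieExp (t • X + ∑ j, (t * c j) • Y j) *
              LinearControl.lieExp (-(t • X))) (Set.Icc 0 T) ∧
          ∀ (J : Set ℝ), J.OrdConnected → Set.Icc 0 T ⊆ J →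
            ∀ γ : ℝ → G, LinearControl.IsSolutionOn 𝒳 Y u 1 γ J →
              ∀ t ∈ Set.Icc 0 T,
                γ t = LinearControl.lieExp (t • X + ∑ j, (t * c j) • Y j) *
                  LinearControl.lieExp (-(t • X))) ∧
    (LieAlgebra.HasTrivialRadical ℝ (GroupLieAlgebra I G) →
      ∃ X : GroupLieAlgebra I G, LinearControl.IsInnerBy 𝒳 X) := by
  have : CompleteSpace E := FiniteDimensional.complete ℝ E
  have : IsManifold I 1 G := IsManifold.of_le (n := ∞) (by simp)
  refine ⟨fun X hX => ?_, fun hG => LinearControl.exists_isInnerBy h𝒳⟩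
  have hV := LinearControl.IsInnerBy.eq_add h𝒳 hX
  refine ⟨by rw [LinearControl.inversionField_rightInvariant, ← hV], fun φ hφ t g => ?_,
    fun m Y u hu T hT c hc => ?_⟩
  · have h1 := LinearControl.isMIntegralCurve_mul_mul X (-X) g
    rw [← hV] at h1
    have h2 := isMIntegralCurve_Ioo_eq_of_contMDiff_boundaryless (t₀ := 0)
      (h𝒳.smooth.of_le (by simp)) (hφ.isMIntegralCurve g) h1
      (by simp [hφ.map_zero, LinearControl.lieExp_zero])
    rw [← smul_neg]
    exact congrFun h2 t
  · set A : GroupLieAlgebra I G := X + ∑ j, c j • Y j with hA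
    have hcurve (t : ℝ) : (LinearControl.lieExp (t • X + ∑ j, (t * c j) • Y j) : G) *
        LinearControl.lieExp (-(t • X)) =
          LinearControl.lieExp (t • A) * 1 * LinearControl.lieExp (t • (-X)) := by
      rw [hA, smul_add, Finset.smul_sum, smul_neg, mul_one]
      simp only [smul_smul]
    have hfield (g : G) : (LinearControl.rightInvariant A + mulInvariantVectorField (-X) :
        (g : G) → TangentSpace I g) g =
          𝒳 g + ∑ j, c j • LinearControl.rightInvariant (Y j) g := by
      rw [hA, LinearControl.rightInvariant_add, ← LinearControl.rightInvariant_sum_smul, hV,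
        add_right_comm]
      rfl
    have hcu := LinearControl.isMIntegralCurve_mul_mul A (-X) (1 : G)
    simp only [hcurve]
    refine ⟨⟨by simp [LinearControl.lieExp_zero], hcu.continuous.continuousOn,
      fun t ht _ => ?_⟩, fun J hJ hTJ γ hγ t ht => ?_⟩
    · rw [hc t ht, ← hfield]
      exact (hcu t).hasMFDerivWithinAt
    · have h := LinearControl.eqOn_of_isMIntegralCurveOn_Ioo (A := A) (B := -X)
        (hγ.continuousOn.mono hTJ) (fun s hs => ?_) ht
      · rw [h, hγ.initial]
      · have hsI := Set.Ioo_subset_Icc_self hs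
        -- At an interior time of `[0, T]` the set `J` is a neighbourhood and the control is locally
        -- constant, so the equation holds there with a two-sided derivative.
        have hJs : J ∈ nhds s :=
          Filter.mem_of_superset (Ioo_mem_nhds hs.1 hs.2) (Set.Ioo_subset_Icc_self.trans hTJ)
        have heq := hγ.equation s (hTJ hsI) (by
          filter_upwards [nhdsWithin_le_nhds (Ioo_mem_nhds hs.1 hs.2)] with τ hτ
          rw [hc s hsI, hc τ (Set.Ioo_subset_Icc_self hτ)])
        rw [hc s hsI, ← hfield] at heq
        exact (heq.hasMFDerivAt hJs).hasMFDerivWithinAt
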